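/- Throughout, $\|\cdot\|$ is the Frobenius norm. Let $\mathcal M\subset\mathbb R^{m\times n}$ be the manifold of matrices of rank $r$ and, for $Y\in\mathcal M$, let $\mathrm P(Y)$ be the orthogonal projection (for the Frobenius inner product) onto the tangent space $T_Y\mathcal M$. **The integrator.** Let $F:[0,T]\times\mathbb R^{m\times n}\to\mathbb R^{m\times n}$. One step from $t_0$ to $t_1=t_0+h$ starts from $Y_0=U_0S_0V_0^\top$, where $U_0\in\mathbb R^{m\times r}$ and $V_0\in\mathbb R^{n\times r}$ have orthonormal columns and $S_0\in\mathbb R^{r\times r}$, and produces $Y_1=U_1S_1V_1^\top$ as follows. * K-step: solve $\dot K(t)=F(t,K(t)V_0^\top)V_0$, $K(t_0)=U_0S_0$, on $[t_0,t_1]$, and take a QR factorization $K(t_1)=U_1R_1$. * L-step: solve $\dot L(t)=F(t,U_0L(t)^\top)^\top U_0$, $L(t_0)=V_0S_0^\top$, on $[t_0,t_1]$, and take a QR factorization $L(t_1)=V_1\widetilde R_1$. * S-step: solve $\dot S(t)=U_1^\top F(t,U_1S(t)V_1^\top)V_1$, $S(t_0)=(U_1^\top U_0)\,S_0\,(V_1^\top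 V_0)^\top$, on $[t_0,t_1]$, and set $S_1=S(t_1)$. **Theorem.** For all real $L,B,T$ there are constants $c_0,c_1,c_2\ge 0$, depending only on $L$, $B$ and $T$, such that the following holds for all $m,n,r$ and $F$. Let $A:[0,T]\to\mathbb R^{m\times n}$ be a solution of $\dot A(t)=F(t,A(t))$, and let $\varepsilon\ge0$, $\delta$, $\rho$ and $h>0$ be such that 1. $\|F(t,Y)-F(t,\widetilde Y)\|\le L\|Y-\widetilde Y\|$ and $\|F(t,Y)\|\le B$ for all $Y,\widetilde Y\in\mathbb R^{m\times n}$ and $0\le t\le T$; 2. $\|(I-\mathrm P(Y))F(t,Y)\|\le\varepsilon$ for all $0\le t\le T$ and all $Y\in\mathcal M$ with $\|Y-A(t)\|<\rho$; 3. $\|Y_0-A(0)\|\le\delta$, where $Y_0=U_0S_0V_0^\top$ is the starting value of the integrator; 4. the neighbourhood in 2 is large enough to contain the approximations: $c_0\delta+c_1\varepsilon+c_2h\le\rho$ (there is no restriction if 2 holds for all $Y\in\mathcal M$). Let $Y_k$ be the approximation after $k$ steps of the integrator with step size $h$. Then, for all $k$ with $t_k=kh\le T$, $$\|Y_k-A(t_k)\|\le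 c_0\delta+c_1\varepsilon+c_2h .$$ In particular, the constants do not depend on singular values of the exact or the approximate solution. -/

import Mathlib

open Set Filter Topology
open scoped Matrix Matrix.Norms.Frobenius

/-- The Frobenius inner product `⟪X, Y⟫ = tr (Xᵀ Y)` on real `m × n` matrices; its norm is
Mathlib's Frobenius norm. -/
noncomputable instance frobeniusInnerProductSpace (m n : ℕ) :
    InnerProductSpace ℝ (Matrix (Fin m) (Fin n) ℝ) where
  inner X Y := (Xᵀ * Y).trace
  norm_sq_eq_re_inner X := by
    have h0 : (0 : ℝ) ≤ ∑ i, ∑ j, X i j ^ 2 :=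
      Finset.sum_nonneg fun i _ => Finset.sum_nonneg fun j _ => sq_nonneg _
    have h1 : ‖X‖ = Real.sqrt (∑ i, ∑ j, X i j ^ 2) := by
      rw [Matrix.frobenius_norm_def, Real.sqrt_eq_rpow]
      simp
    rw [h1, Real.sq_sqrt h0, Finset.sum_comm]
    simp [Matrix.trace, Matrix.mul_apply, pow_two]
  conj_inner_symm X Y := by
    have h : (Yᵀ * X).trace = (Xᵀ * Y).trace := by
      rw [← Matrix.trace_transpose, Matrix.transpose_mul, Matrix.transpose_transpose]
    simpa using h
  add_left X Y Z := by
    simp [Matrix.add_mul]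
  smul_left X Y a := by
    simp

/-- The set of real `m × n` matrices of rank exactly `r`. -/
def rankManifold (m n r : ℕ) : Set (Matrix (Fin m) (Fin n) ℝ) :=
  {Y | Y.rank = r}

/-- The tangent space at `Y` of the manifold of rank-`r` matrices: the space of velocities
`γ'(0)` of curves `γ` of rank-`r` matrices with `γ(0) = Y`. -/
def rankTangentSpace {m n : ℕ} (r : ℕ) (Y : Matrix (Fin m) (Fin n) ℝ) :
    Submodule ℝ (Matrix (Fin m) (Fin n) ℝ) :=
  Submodule.span ℝ {W | ∃ γ : ℝ → Matrix (Fin m) (Fin n) ℝ,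
    γ 0 = Y ∧ (∀ᶠ s in 𝓝 (0 : ℝ), γ s ∈ rankManifold m n r) ∧ HasDerivAt γ W 0}

/-- `P(Y)`: the orthogonal projection (for the Frobenius inner product) onto the tangent space
at `Y` of the manifold of rank-`r` matrices. -/
noncomputable def tangentProj {m n : ℕ} (r : ℕ) (Y : Matrix (Fin m) (Fin n) ℝ) :
    Matrix (Fin m) (Fin n) ℝ →L[ℝ] Matrix (Fin m) (Fin n) ℝ :=
  (rankTangentSpace r Y).starProjection

/-- `X` solves the matrix differential equation `X'(t) = G(t, X(t))` on `[a, b]`. -/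
def IsSolutionOn {p q : ℕ} (G : ℝ → Matrix (Fin p) (Fin q) ℝ → Matrix (Fin p) (Fin q) ℝ)
    (a b : ℝ) (X : ℝ → Matrix (Fin p) (Fin q) ℝ) : Prop :=
  ∀ t ∈ Icc a b, HasDerivWithinAt X (G t (X t)) (Icc a b) t

/-- `Q` has orthonormal columns. -/
def HasOrthonormalCols {p r : ℕ} (Q : Matrix (Fin p) (Fin r) ℝ) : Prop :=
  Qᵀ * Q = 1

/-- `K = Q R` is a (slim) QR factorization: `Q` has orthonormal columns and the square matrix
`R` is upper triangular. -/
def IsQR {p r : ℕ} (K Q : Matrix (Fin p) (Fin r) ℝ) (R : Matrix (Fin r) (Fin r) ℝ) : Prop :=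
  K = Q * R ∧ HasOrthonormalCols Q ∧ ∀ i j, j < i → R i j = 0

/-- One step of the integrator from `t₀` to `t₀ + h`, leading from the factors
`(U₀, S₀, V₀)` to `(U₁, S₁, V₁)`. Any QR factorizations may be chosen in the K- and L-steps. -/
def IsIntegratorStep {m n r : ℕ}
    (F : ℝ → Matrix (Fin m) (Fin n) ℝ → Matrix (Fin m) (Fin n) ℝ) (t₀ h : ℝ)
    (U₀ : Matrix (Fin m) (Fin r) ℝ) (S₀ : Matrix (Fin r) (Fin r) ℝ)
    (V₀ : Matrix (Fin n) (Fin r) ℝ)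
    (U₁ : Matrix (Fin m) (Fin r) ℝ) (S₁ : Matrix (Fin r) (Fin r) ℝ)
    (V₁ : Matrix (Fin n) (Fin r) ℝ) : Prop :=
  -- K-step
  (∃ (K : ℝ → Matrix (Fin m) (Fin r) ℝ) (R : Matrix (Fin r) (Fin r) ℝ),
    IsSolutionOn (fun t X => F t (X * V₀ᵀ) * V₀) t₀ (t₀ + h) K ∧
    K t₀ = U₀ * S₀ ∧
    IsQR (K (t₀ + h)) U₁ R) ∧
  -- L-step
  (∃ (L : ℝ → Matrix (Fin n) (Fin r) ℝ) (R : Matrix (Fin r) (Fin r) ℝ),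
    IsSolutionOn (fun t X => (F t (U₀ * Xᵀ))ᵀ * U₀) t₀ (t₀ + h) L ∧
    L t₀ = V₀ * S₀ᵀ ∧
    IsQR (L (t₀ + h)) V₁ R) ∧
  -- S-step
  (∃ S : ℝ → Matrix (Fin r) (Fin r) ℝ,
    IsSolutionOn (fun t X => U₁ᵀ * F t (U₁ * X * V₁ᵀ) * V₁) t₀ (t₀ + h) S ∧
    S t₀ = (U₁ᵀ * U₀) * S₀ * (V₁ᵀ * V₀)ᵀ ∧
    S (t₀ + h) = S₁)

/-!
Let `e` be the error at the beginning of a step and `η = O(h (e + h + ε))`. Since the K-step ends in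
the column space of `U₁`, applying `I - U₁U₁ᵀ` to `A - K V₀ᵀ` shows that this column space contains
`W = Y₀ + A(t₁) - A(t₀)` up to `η`: on the row space of `V₀ᵀ` both curves follow `F`, up to a
Lipschitz error, and on its complement only the normal component of `F` at the endpoint of the
K-step enters, which is at most `ε`. The L-step is the K-step of the transposed problem and gives
the same for the row space. The S-step is a Galerkin method on these two spaces, so it loses only
another `η`. Since no inverse of a core matrix `S` appears, small singular values do no harm; the
bound on the normal component extends to matrices of rank less than `r` by density. The resulting
recursion `e ↦ (1 + αh) e + h (βh + κε)` is summed by the discrete Grönwall inequality, which at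
the same time keeps the approximations in the neighbourhood where the hypothesis on `F` holds.
-/

open scoped NNReal

section MatrixAlgebra

variable {m n r 𝕜 : Type*} [Fintype n] [Fintype r]

theorem exists_eq_mul_mul_of_rank_le [Field 𝕜] {Y : Matrix m n 𝕜} {V : Matrix n r 𝕜}
    (hrank : Y.rank ≤ (Y * V).rank) : ∃ X : Matrix r n 𝕜, Y = Y * V * X := by
  classical
  have hrange : LinearMap.range (Y * V).mulVecLin = LinearMap.range Y.mulVecLin := by
    refine Submodule.eq_of_le_of_finrank_le ?_ hrank
    rw [Matrix.mulVecLin_mul]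
    exact LinearMap.range_comp_le_range _ _
  have hcol (j : n) : ∃ x, (Y * V) *ᵥ x = Y.col j := by
    have hj : Y.col j ∈ LinearMap.range Y.mulVecLin := ⟨Pi.single j 1, by simp⟩
    simpa [← hrange] using hj
  choose x hx using hcol
  exact ⟨Matrix.of fun i j => x j i, Matrix.ext fun i j => (congrFun (hx j) i).symm⟩

theorem eq_mul_inv_mul_of_rank_le [Fintype m] [DecidableEq r] [Field 𝕜] {Y : Matrix m n 𝕜}
    {U : Matrix r m 𝕜} {V : Matrix n r 𝕜} (hrank : Y.rank ≤ Fintype.card r)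
    (hcore : IsUnit (U * Y * V)) :
    Y = Y * V * (U * Y * V)⁻¹ * (U * Y) := by
  have hYV : Y.rank ≤ (Y * V).rank := calc
    Y.rank ≤ (U * Y * V).rank := by rwa [Matrix.rank_of_isUnit _ hcore]
    _ ≤ (Y * V).rank := by rw [Matrix.mul_assoc]; exact Matrix.rank_mul_le_right _ _
  obtain ⟨X, hX⟩ := exists_eq_mul_mul_of_rank_le hYV
  have hUY : U * Y = U * Y * V * X := by
    simpa only [Matrix.mul_assoc] using congrArg (U * ·) hX
  have hinv : (U * Y * V)⁻¹ * (U * Y * V) = 1 :=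
    Matrix.nonsing_inv_mul _ ((Matrix.isUnit_iff_isUnit_det _).1 hcore)
  calc Y = Y * V * X := hX
    _ = Y * V * ((U * Y * V)⁻¹ * (U * Y * V)) * X := by rw [hinv, Matrix.mul_one]
    _ = Y * V * (U * Y * V)⁻¹ * (U * Y * V * X) := by simp only [Matrix.mul_assoc]
    _ = Y * V * (U * Y * V)⁻¹ * (U * Y) := by rw [← hUY]

theorem dense_setOf_isUnit_matrix [DecidableEq r] [NontriviallyNormedField 𝕜] [CompleteSpace 𝕜] :
    Dense {R : Matrix r r 𝕜 | IsUnit R} := by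
  intro R
  have hfin : {s : 𝕜 | (-R).charpoly.IsRoot s}.Finite :=
    Polynomial.finite_setOfPred_isRoot (Matrix.charpoly_monic _).ne_zero
  have hcont : Continuous fun s : 𝕜 => s • (1 : Matrix r r 𝕜) + R := by fun_prop
  have hmaps : MapsTo (fun s : 𝕜 => s • (1 : Matrix r r 𝕜) + R)
      {s : 𝕜 | (-R).charpoly.IsRoot s}ᶜ {R | IsUnit R} := fun s hs => by
    rwa [mem_compl_iff, mem_ofPred_eq, Polynomial.IsRoot, Matrix.eval_charpoly, sub_neg_eq_add,
      Matrix.scalar_apply, ← Matrix.smul_one_eq_diagonal, ← Ne, ← isUnit_iff_ne_zero,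
      ← Matrix.isUnit_iff_isUnit_det] at hs
  simpa using map_mem_closure hcont (hfin.countable.dense_compl 𝕜 0) hmaps

end MatrixAlgebra

section OrthonormalColumns

variable {m n r : ℕ} {U : Matrix (Fin m) (Fin r) ℝ} {V : Matrix (Fin n) (Fin r) ℝ}

/-- `I - U Uᵀ`: the orthogonal projection onto the orthogonal complement of the column space of a
matrix `U` with orthonormal columns. -/
def orthComplProj (U : Matrix (Fin m) (Fin r) ℝ) : Matrix (Fin m) (Fin m) ℝ :=
  1 - U * Uᵀ

theorem transpose_orthComplProj : (orthComplProj U)ᵀ = orthComplProj U := by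
  simp [orthComplProj]

theorem HasOrthonormalCols.transpose_mul_cancel (hU : HasOrthonormalCols U)
    (X : Matrix (Fin r) (Fin n) ℝ) : Uᵀ * (U * X) = X := by
  rw [← Matrix.mul_assoc, show Uᵀ * U = 1 from hU, Matrix.one_mul]

theorem HasOrthonormalCols.mul_transpose_mul_cancel (hV : HasOrthonormalCols V)
    (X : Matrix (Fin m) (Fin r) ℝ) : X * Vᵀ * V = X := by
  rw [Matrix.mul_assoc, show Vᵀ * V = 1 from hV, Matrix.mul_one]

theorem HasOrthonormalCols.orthComplProj_mul (hU : HasOrthonormalCols U)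
    (X : Matrix (Fin r) (Fin n) ℝ) : orthComplProj U * (U * X) = 0 := by
  rw [orthComplProj, Matrix.sub_mul, Matrix.one_mul, Matrix.mul_assoc, hU.transpose_mul_cancel,
    sub_self]

theorem HasOrthonormalCols.mul_orthComplProj (hV : HasOrthonormalCols V)
    (X : Matrix (Fin m) (Fin r) ℝ) : X * Vᵀ * orthComplProj V = 0 := by
  rw [orthComplProj, Matrix.mul_sub, Matrix.mul_one, ← Matrix.mul_assoc,
    hV.mul_transpose_mul_cancel, sub_self]

theorem HasOrthonormalCols.rank_mul_mul_transpose (hU : HasOrthonormalCols U)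
    (hV : HasOrthonormalCols V) (R : Matrix (Fin r) (Fin r) ℝ) :
    (U * R * Vᵀ).rank = R.rank := by
  apply le_antisymm
  · exact (Matrix.rank_mul_le_left _ _).trans (Matrix.rank_mul_le_right _ _)
  · have hcore : Uᵀ * (U * R * Vᵀ) * V = R := by
      rw [Matrix.mul_assoc U, hU.transpose_mul_cancel, hV.mul_transpose_mul_cancel]
    calc R.rank = (Uᵀ * (U * R * Vᵀ) * V).rank := by rw [hcore]
      _ ≤ (Uᵀ * (U * R * Vᵀ)).rank := Matrix.rank_mul_le_left _ _
      _ ≤ (U * R * Vᵀ).rank := Matrix.rank_mul_le_right _ _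

theorem frobenius_norm_sq_eq_trace (X : Matrix (Fin m) (Fin n) ℝ) : ‖X‖ ^ 2 = (Xᵀ * X).trace :=
  (frobeniusInnerProductSpace m n).norm_sq_eq_re_inner X

theorem HasOrthonormalCols.norm_mul (hU : HasOrthonormalCols U) (X : Matrix (Fin r) (Fin n) ℝ) :
    ‖U * X‖ = ‖X‖ := by
  rw [← sq_eq_sq₀ (norm_nonneg _) (norm_nonneg _), frobenius_norm_sq_eq_trace,
    frobenius_norm_sq_eq_trace, Matrix.transpose_mul, Matrix.mul_assoc, hU.transpose_mul_cancel]

theorem HasOrthonormalCols.norm_mul_transpose (hV : HasOrthonormalCols V)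
    (X : Matrix (Fin m) (Fin r) ℝ) : ‖X * Vᵀ‖ = ‖X‖ := by
  rw [← Matrix.frobenius_norm_transpose, Matrix.transpose_mul, Matrix.transpose_transpose,
    hV.norm_mul, Matrix.frobenius_norm_transpose]

theorem HasOrthonormalCols.norm_sq_add_norm_sq (hU : HasOrthonormalCols U)
    (X : Matrix (Fin m) (Fin n) ℝ) : ‖Uᵀ * X‖ ^ 2 + ‖orthComplProj U * X‖ ^ 2 = ‖X‖ ^ 2 := by
  have hgram : (orthComplProj U * X)ᵀ * (orthComplProj U * X) = Xᵀ * X - (Uᵀ * X)ᵀ * (Uᵀ * X) := by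
    simp only [orthComplProj, Matrix.sub_mul, Matrix.mul_sub, Matrix.transpose_sub,
      Matrix.transpose_mul, Matrix.transpose_transpose, Matrix.one_mul, Matrix.mul_assoc,
      hU.transpose_mul_cancel]
    abel
  rw [frobenius_norm_sq_eq_trace, frobenius_norm_sq_eq_trace, frobenius_norm_sq_eq_trace, hgram,
    Matrix.trace_sub, add_sub_cancel]

theorem HasOrthonormalCols.norm_transpose_mul_le (hU : HasOrthonormalCols U)
    (X : Matrix (Fin m) (Fin n) ℝ) : ‖Uᵀ * X‖ ≤ ‖X‖ :=
  (sq_le_sq₀ (norm_nonneg _) (norm_nonneg _)).1 <| by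
    linarith [hU.norm_sq_add_norm_sq X, sq_nonneg ‖orthComplProj U * X‖]

theorem HasOrthonormalCols.norm_orthComplProj_mul_le (hU : HasOrthonormalCols U)
    (X : Matrix (Fin m) (Fin n) ℝ) : ‖orthComplProj U * X‖ ≤ ‖X‖ :=
  (sq_le_sq₀ (norm_nonneg _) (norm_nonneg _)).1 <| by
    linarith [hU.norm_sq_add_norm_sq X, sq_nonneg ‖Uᵀ * X‖]

theorem HasOrthonormalCols.norm_mul_le (hV : HasOrthonormalCols V)
    (X : Matrix (Fin m) (Fin n) ℝ) : ‖X * V‖ ≤ ‖X‖ := by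
  simpa only [← Matrix.transpose_mul, Matrix.frobenius_norm_transpose] using
    hV.norm_transpose_mul_le Xᵀ

theorem HasOrthonormalCols.norm_mul_orthComplProj_le (hV : HasOrthonormalCols V)
    (X : Matrix (Fin m) (Fin n) ℝ) : ‖X * orthComplProj V‖ ≤ ‖X‖ := by
  rw [← Matrix.frobenius_norm_transpose, Matrix.transpose_mul, transpose_orthComplProj,
    ← Matrix.frobenius_norm_transpose X]
  exact hV.norm_orthComplProj_mul_le Xᵀ

theorem HasOrthonormalCols.norm_orthComplProj_mul_sub_le (hU : HasOrthonormalCols U)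
    (hV : HasOrthonormalCols V) (X Y Z : Matrix (Fin m) (Fin n) ℝ) :
    ‖orthComplProj U * (X - Y * V * Vᵀ)‖ ≤
      ‖X - Y‖ + ‖X - Z‖ + ‖orthComplProj U * Z * orthComplProj V‖ := by
  have hsplit : X - Y * V * Vᵀ =
      (X - Y) * V * Vᵀ + (X - Z) * orthComplProj V + Z * orthComplProj V := by
    simp only [orthComplProj, Matrix.sub_mul, Matrix.mul_sub, Matrix.mul_one, Matrix.mul_assoc]
    abel
  have hrange : ‖orthComplProj U * ((X - Y) * V * Vᵀ)‖ ≤ ‖X - Y‖ :=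
    (hU.norm_orthComplProj_mul_le _).trans <|
      (hV.norm_mul_transpose _).trans_le (hV.norm_mul_le _)
  have hcorange : ‖orthComplProj U * ((X - Z) * orthComplProj V)‖ ≤ ‖X - Z‖ :=
    (hU.norm_orthComplProj_mul_le _).trans (hV.norm_mul_orthComplProj_le _)
  rw [hsplit, Matrix.mul_add, Matrix.mul_add, Matrix.mul_assoc _ Z]
  exact norm_add₃_le.trans (by gcongr)

end OrthonormalColumns

section Calculus

variable {l m n p q : Type*}

theorem hasDerivWithinAt_mul_mul [Fintype m] [Fintype n] [Finite p] [Finite q]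
    {f : ℝ → Matrix m n ℝ} {f' : Matrix m n ℝ} {s : Set ℝ} {x : ℝ} (hf : HasDerivWithinAt f f' s x)
    (P : Matrix p m ℝ) (Q : Matrix n q ℝ) :
    HasDerivWithinAt (fun t => P * f t * Q) (P * f' * Q) s x := by
  cases nonempty_fintype p
  cases nonempty_fintype q
  exact (mulRightLinearMap p ℝ Q ∘ₗ mulLeftLinearMap n ℝ P).toContinuousLinearMap.hasFDerivAt
    |>.comp_hasDerivWithinAt x hf

theorem hasDerivWithinAt_transpose [Finite m] [Finite n] {f : ℝ → Matrix m n ℝ}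
    {f' : Matrix m n ℝ} {s : Set ℝ} {x : ℝ} (hf : HasDerivWithinAt f f' s x) :
    HasDerivWithinAt (fun t => (f t)ᵀ) f'ᵀ s x := by
  cases nonempty_fintype m
  cases nonempty_fintype n
  exact (Matrix.transposeLinearEquiv m n ℝ ℝ).toContinuousLinearEquiv.hasFDerivAt
    |>.comp_hasDerivWithinAt x hf

theorem hasDerivAt_mul_of_eq_zero [Finite l] [Fintype m] [Finite n] {f : ℝ → Matrix l m ℝ}
    {g : ℝ → Matrix m n ℝ} {f' : Matrix l m ℝ} {x : ℝ}
    (hf : HasDerivAt f f' x) (hx : f x = 0) (hg : ContinuousAt g x) :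
    HasDerivAt (fun t => f t * g t) (f' * g x) x := by
  cases nonempty_fintype l
  cases nonempty_fintype n
  have hslope : slope (fun t => f t * g t) x = fun t => slope f x t * g t := by
    ext1 t
    simp only [slope_def_module, hx, Matrix.zero_mul, sub_zero, Matrix.smul_mul]
  have hmul := ((continuous_fst.matrix_mul continuous_snd).tendsto (f', g x)).comp
    (hf.tendsto_slope.prodMk_nhds (hg.tendsto.mono_left nhdsWithin_le_nhds))
  refine hasDerivAt_iff_tendsto_slope.2 ?_
  rw [hslope]
  exact hmul

variable {E : Type*} [NormedAddCommGroup E] [NormedSpace ℝ E] {f f' g g' : ℝ → E} {a h C : ℝ}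

theorem norm_sub_le_of_norm_hasDerivWithinAt_le
    (hf : ∀ t ∈ Icc a (a + h), HasDerivWithinAt f (f' t) (Icc a (a + h)) t)
    (hC : ∀ t ∈ Icc a (a + h), ‖f' t‖ ≤ C) {s t : ℝ} (hs : s ∈ Icc a (a + h))
    (ht : t ∈ Icc a (a + h)) : ‖f t - f s‖ ≤ C * h := by
  have hC0 : 0 ≤ C := (norm_nonneg _).trans (hC s hs)
  have hts : ‖t - s‖ ≤ h := by
    rw [Real.norm_eq_abs, abs_sub_le_iff]
    constructor <;> linarith [hs.1, hs.2, ht.1, ht.2]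
  exact (Convex.norm_image_sub_le_of_norm_hasDerivWithin_le hf hC (convex_Icc _ _) hs ht).trans
    (mul_le_mul_of_nonneg_left hts hC0)

theorem norm_sub_le_add_two_mul_of_norm_hasDerivWithinAt_le
    (hf : ∀ t ∈ Icc a (a + h), HasDerivWithinAt f (f' t) (Icc a (a + h)) t)
    (hg : ∀ t ∈ Icc a (a + h), HasDerivWithinAt g (g' t) (Icc a (a + h)) t)
    (hf' : ∀ t ∈ Icc a (a + h), ‖f' t‖ ≤ C) (hg' : ∀ t ∈ Icc a (a + h), ‖g' t‖ ≤ C) {s t : ℝ}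
    (hs : s ∈ Icc a (a + h)) (ht : t ∈ Icc a (a + h)) :
    ‖f s - g t‖ ≤ ‖f a - g a‖ + 2 * C * h := by
  have ha : a ∈ Icc a (a + h) := ⟨le_rfl, hs.1.trans hs.2⟩
  have hfs := norm_sub_le_of_norm_hasDerivWithinAt_le hf hf' ha hs
  have hgt := norm_sub_le_of_norm_hasDerivWithinAt_le hg hg' ha ht
  calc ‖f s - g t‖ = ‖(f a - g a) + (f s - f a) - (g t - g a)‖ := by congr 1; abel
    _ ≤ ‖f a - g a‖ + ‖f s - f a‖ + ‖g t - g a‖ :=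
      (norm_sub_le _ _).trans (by gcongr; exact norm_add_le _ _)
    _ ≤ ‖f a - g a‖ + 2 * C * h := by linarith

end Calculus

section TangentSpace

variable {m n r : ℕ} {U : Matrix (Fin m) (Fin r) ℝ} {V : Matrix (Fin n) (Fin r) ℝ}
  {R : Matrix (Fin r) (Fin r) ℝ}

theorem orthComplProj_mul_velocity_mul_orthComplProj (hU : HasOrthonormalCols U)
    (hV : HasOrthonormalCols V) (hR : IsUnit R) {γ : ℝ → Matrix (Fin m) (Fin n) ℝ}
    {W : Matrix (Fin m) (Fin n) ℝ} {x : ℝ} (hx : γ x = U * R * Vᵀ)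
    (hrank : ∀ᶠ s in 𝓝 x, (γ s).rank ≤ r) (hγ : HasDerivAt γ W x) :
    orthComplProj U * W * orthComplProj V = 0 := by
  have hderiv {p q : ℕ} (P : Matrix (Fin p) (Fin m) ℝ) (Q : Matrix (Fin n) (Fin q) ℝ) :
      HasDerivAt (fun s => P * γ s * Q) (P * W * Q) x :=
    (hasDerivWithinAt_mul_mul hγ.hasDerivWithinAt P Q).hasDerivAt univ_mem
  have hleft : orthComplProj U * γ x * V = 0 := by
    rw [hx, Matrix.mul_assoc U, hU.orthComplProj_mul, Matrix.zero_mul]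
  have hright : Uᵀ * γ x * orthComplProj V = 0 := by
    rw [hx, ← Matrix.mul_assoc, hV.mul_orthComplProj]
  have hcore : Uᵀ * γ x * V = R := by
    rw [hx, Matrix.mul_assoc U, hU.transpose_mul_cancel, hV.mul_transpose_mul_cancel]
  have hdet : IsUnit (Uᵀ * γ x * V).det := by
    rwa [hcore, ← Matrix.isUnit_iff_isUnit_det]
  have hinv : ContinuousAt (fun s => (Uᵀ * γ s * V)⁻¹) x :=
    ContinuousAt.comp (f := fun s => Uᵀ * γ s * V)
      (continuousAt_matrix_inv _ (NormedRing.inverse_continuousAt hdet.unit))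
      (hderiv Uᵀ V).continuousAt
  have hfactor : ContinuousAt (fun s => (Uᵀ * γ s * V)⁻¹ * (Uᵀ * γ s * orthComplProj V)) x :=
    (continuous_fst.matrix_mul continuous_snd).continuousAt.comp
      (hinv.prodMk (hderiv Uᵀ (orthComplProj V)).continuousAt)
  have hunit : ∀ᶠ s in 𝓝 x, IsUnit (Uᵀ * γ s * V) :=
    (hderiv Uᵀ V).continuousAt.eventually_mem
      (Units.isOpen.mem_nhds (show IsUnit (Uᵀ * γ x * V) by rwa [hcore]))
  -- `(I - UUᵀ) γ (I - VVᵀ)` factors through the core `Uᵀ γ V`; both outer factors vanish at `x`.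
  have hfactored : (fun s => orthComplProj U * γ s * orthComplProj V) =ᶠ[𝓝 x] fun s =>
      orthComplProj U * γ s * V * ((Uᵀ * γ s * V)⁻¹ * (Uᵀ * γ s * orthComplProj V)) := by
    filter_upwards [hrank, hunit] with s hs hs'
    have hγs := eq_mul_inv_mul_of_rank_le (hs.trans_eq (Fintype.card_fin r).symm) hs'
    calc orthComplProj U * γ s * orthComplProj V
        = orthComplProj U * (γ s * V * (Uᵀ * γ s * V)⁻¹ * (Uᵀ * γ s)) * orthComplProj V := by
          rw [← hγs]
      _ = _ := by simp only [Matrix.mul_assoc]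
  have hprod := hasDerivAt_mul_of_eq_zero (hderiv (orthComplProj U) V) hleft hfactor
  rw [hright, Matrix.mul_zero, Matrix.mul_zero] at hprod
  exact (hderiv _ _).unique (hprod.congr_of_eventuallyEq hfactored)

theorem orthComplProj_mul_mul_orthComplProj_of_mem_rankTangentSpace (hU : HasOrthonormalCols U)
    (hV : HasOrthonormalCols V) (hR : IsUnit R) {W : Matrix (Fin m) (Fin n) ℝ}
    (hW : W ∈ rankTangentSpace r (U * R * Vᵀ)) :
    orthComplProj U * W * orthComplProj V = 0 := by
  induction hW using Submodule.span_induction with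
  | mem W hW =>
    obtain ⟨γ, hγ0, hrank, hγ⟩ := hW
    exact orthComplProj_mul_velocity_mul_orthComplProj hU hV hR hγ0
      (hrank.mono fun s hs => le_of_eq hs) hγ
  | zero => rw [Matrix.mul_zero, Matrix.zero_mul]
  | add X Y _ _ hX hY => rw [Matrix.mul_add, Matrix.add_mul, hX, hY, add_zero]
  | smul c X _ hX => rw [Matrix.mul_smul, Matrix.smul_mul, hX, smul_zero]

theorem norm_orthComplProj_mul_mul_orthComplProj_le (hU : HasOrthonormalCols U)
    (hV : HasOrthonormalCols V) (hR : IsUnit R) (X : Matrix (Fin m) (Fin n) ℝ) :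
    ‖orthComplProj U * X * orthComplProj V‖ ≤ ‖X - tangentProj r (U * R * Vᵀ) X‖ := by
  have htangent : orthComplProj U * tangentProj r (U * R * Vᵀ) X * orthComplProj V = 0 :=
    orthComplProj_mul_mul_orthComplProj_of_mem_rankTangentSpace hU hV hR
      (Submodule.starProjection_apply_mem _ _)
  calc ‖orthComplProj U * X * orthComplProj V‖
      = ‖orthComplProj U * (X - tangentProj r (U * R * Vᵀ) X) * orthComplProj V‖ := by
        rw [Matrix.mul_sub, Matrix.sub_mul, htangent, sub_zero]
    _ ≤ ‖X - tangentProj r (U * R * Vᵀ) X‖ :=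
        (hV.norm_mul_orthComplProj_le _).trans (hU.norm_orthComplProj_mul_le _)

theorem norm_orthComplProj_mul_mul_orthComplProj_le_of_ball
    {G : Matrix (Fin m) (Fin n) ℝ → Matrix (Fin m) (Fin n) ℝ} (hG : Continuous G)
    {A : Matrix (Fin m) (Fin n) ℝ} {ε ρ : ℝ}
    (hnormal : ∀ Y ∈ rankManifold m n r, ‖Y - A‖ < ρ → ‖G Y - tangentProj r Y (G Y)‖ ≤ ε)
    (hU : HasOrthonormalCols U) (hV : HasOrthonormalCols V) (hR : ‖U * R * Vᵀ - A‖ < ρ) :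
    ‖orthComplProj U * G (U * R * Vᵀ) * orthComplProj V‖ ≤ ε := by
  have hY : Continuous fun R : Matrix (Fin r) (Fin r) ℝ => U * R * Vᵀ := by fun_prop
  have hopen : IsOpen {R : Matrix (Fin r) (Fin r) ℝ | ‖U * R * Vᵀ - A‖ < ρ} :=
    isOpen_lt (hY.sub continuous_const).norm continuous_const
  have hclosed : IsClosed {R : Matrix (Fin r) (Fin r) ℝ |
      ‖orthComplProj U * G (U * R * Vᵀ) * orthComplProj V‖ ≤ ε} :=
    isClosed_le (by fun_prop) continuous_const
  have hinvertible : {R : Matrix (Fin r) (Fin r) ℝ | ‖U * R * Vᵀ - A‖ < ρ} ∩ {R | IsUnit R} ⊆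
      {R | ‖orthComplProj U * G (U * R * Vᵀ) * orthComplProj V‖ ≤ ε} := fun R' hR' => by
    have hmem : (U * R' * Vᵀ).rank = r := by
      rw [hU.rank_mul_mul_transpose hV, Matrix.rank_of_isUnit _ hR'.2, Fintype.card_fin]
    exact (norm_orthComplProj_mul_mul_orthComplProj_le hU hV hR'.2 _).trans
      (hnormal _ hmem hR'.1)
  exact hclosed.closure_subset_iff.2 hinvertible
    (dense_setOf_isUnit_matrix.open_subset_closure_inter hopen hR)

end TangentSpace

section Flow

variable {m n r : ℕ} {F : ℝ → Matrix (Fin m) (Fin n) ℝ → Matrix (Fin m) (Fin n) ℝ}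
  {A : ℝ → Matrix (Fin m) (Fin n) ℝ} {a b a' b' h : ℝ} {L B : ℝ≥0} {ε ρ : ℝ}

/-- `A` is a solution of `A'(t) = F(t, A(t))` on `[a, b]`, where `F` is Lipschitz continuous with
constant `L` and bounded by `B`. -/
structure IsLipschitzBoundedFlow
    (F : ℝ → Matrix (Fin m) (Fin n) ℝ → Matrix (Fin m) (Fin n) ℝ)
    (A : ℝ → Matrix (Fin m) (Fin n) ℝ) (a b : ℝ) (L B : ℝ≥0) : Prop where
  isSolutionOn : IsSolutionOn F a b A
  lipschitz : ∀ t ∈ Icc a b, LipschitzWith L (F t)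
  norm_le : ∀ t ∈ Icc a b, ∀ Y, ‖F t Y‖ ≤ B

/-- A Lipschitz bounded flow whose vector field is `ε`-close to tangential on the matrices
`Y = U R Vᵀ` in the `ρ`-neighbourhood of the solution. The normal component at `Y` is expressed
as `(I - U Uᵀ) F(t, Y) (I - V Vᵀ)`, which makes sense also when `Y` has rank less than `r`. -/
structure IsNearlyTangentFlow
    (F : ℝ → Matrix (Fin m) (Fin n) ℝ → Matrix (Fin m) (Fin n) ℝ)
    (A : ℝ → Matrix (Fin m) (Fin n) ℝ) (r : ℕ) (a b : ℝ) (L B : ℝ≥0) (ε ρ : ℝ) : Prop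
    extends IsLipschitzBoundedFlow F A a b L B where
  norm_normal_le : ∀ t ∈ Icc a b, ∀ (U : Matrix (Fin m) (Fin r) ℝ) (R : Matrix (Fin r) (Fin r) ℝ)
    (V : Matrix (Fin n) (Fin r) ℝ), HasOrthonormalCols U → HasOrthonormalCols V →
      ‖U * R * Vᵀ - A t‖ < ρ → ‖orthComplProj U * F t (U * R * Vᵀ) * orthComplProj V‖ ≤ ε

theorem IsSolutionOn.mono (hA : IsSolutionOn F a b A) (hsub : Icc a' b' ⊆ Icc a b) :
    IsSolutionOn F a' b' A :=
  fun t ht => (hA t (hsub ht)).mono hsub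

theorem IsSolutionOn.transpose (hA : IsSolutionOn F a b A) :
    IsSolutionOn (fun t X => (F t Xᵀ)ᵀ) a b (fun t => (A t)ᵀ) :=
  fun t ht => hasDerivWithinAt_transpose (hA t ht)

theorem IsNearlyTangentFlow.mono (hF : IsNearlyTangentFlow F A r a b L B ε ρ)
    (hsub : Icc a' b' ⊆ Icc a b) : IsNearlyTangentFlow F A r a' b' L B ε ρ where
  isSolutionOn := hF.isSolutionOn.mono hsub
  lipschitz t ht := hF.lipschitz t (hsub ht)
  norm_le t ht := hF.norm_le t (hsub ht)
  norm_normal_le t ht := hF.norm_normal_le t (hsub ht)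

theorem IsNearlyTangentFlow.transpose (hF : IsNearlyTangentFlow F A r a b L B ε ρ) :
    IsNearlyTangentFlow (fun t X => (F t Xᵀ)ᵀ) (fun t => (A t)ᵀ) r a b L B ε ρ where
  isSolutionOn := hF.isSolutionOn.transpose
  lipschitz t ht := LipschitzWith.of_dist_le_mul fun X Y => by
    simpa only [dist_eq_norm, ← Matrix.transpose_sub, Matrix.frobenius_norm_transpose] using
      (hF.lipschitz t ht).dist_le_mul Xᵀ Yᵀ
  norm_le t ht Y := (Matrix.frobenius_norm_transpose _).trans_le (hF.norm_le t ht Yᵀ)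
  norm_normal_le t ht U R V hU hV hR := by
    have hfactors : (U * R * Vᵀ)ᵀ = V * Rᵀ * Uᵀ := by
      simp only [Matrix.transpose_mul, Matrix.transpose_transpose, Matrix.mul_assoc]
    rw [← Matrix.frobenius_norm_transpose, Matrix.transpose_sub, Matrix.transpose_transpose,
      hfactors] at hR
    rw [← Matrix.frobenius_norm_transpose, Matrix.transpose_mul, Matrix.transpose_mul,
      Matrix.transpose_transpose, transpose_orthComplProj, transpose_orthComplProj, hfactors,
      ← Matrix.mul_assoc]
    exact hF.norm_normal_le t ht V Rᵀ U hV hU hR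

theorem isNearlyTangentFlow_of_tangentProj {L B : ℝ} (hA : IsSolutionOn F a b A)
    (hLip : ∀ t ∈ Icc a b, ∀ Y Y', ‖F t Y - F t Y'‖ ≤ L * ‖Y - Y'‖)
    (hB : ∀ t ∈ Icc a b, ∀ Y, ‖F t Y‖ ≤ B)
    (hnormal : ∀ t ∈ Icc a b, ∀ Y ∈ rankManifold m n r, ‖Y - A t‖ < ρ →
      ‖F t Y - tangentProj r Y (F t Y)‖ ≤ ε) :
    IsNearlyTangentFlow F A r a b L.toNNReal B.toNNReal ε ρ := by
  have hlip (t : ℝ) (ht : t ∈ Icc a b) : LipschitzWith L.toNNReal (F t) :=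
    LipschitzWith.of_dist_le' fun X Y => by simpa only [dist_eq_norm] using hLip t ht X Y
  exact
    { isSolutionOn := hA
      lipschitz := hlip
      norm_le := fun t ht Y => (hB t ht Y).trans B.le_coe_toNNReal
      norm_normal_le := fun t ht U R V hU hV hR =>
        norm_orthComplProj_mul_mul_orthComplProj_le_of_ball (hlip t ht).continuous (hnormal t ht)
          hU hV hR }

theorem IsLipschitzBoundedFlow.norm_apply_sub_le (hF : IsLipschitzBoundedFlow F A a b L B) {t d : ℝ}
    (ht : t ∈ Icc a b) {X Y : Matrix (Fin m) (Fin n) ℝ} (hXY : ‖X - Y‖ ≤ d) :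
    ‖F t X - F t Y‖ ≤ L * d :=
  ((hF.lipschitz t ht).norm_sub_le X Y).trans (by gcongr)

theorem IsLipschitzBoundedFlow.norm_sub_le (hF : IsLipschitzBoundedFlow F A a (a + h) L B)
    (hh : 0 ≤ h) : ‖A (a + h) - A a‖ ≤ B * h :=
  norm_sub_le_of_norm_hasDerivWithinAt_le hF.isSolutionOn (fun t ht => hF.norm_le t ht _)
    ⟨le_rfl, by linarith⟩ ⟨by linarith, le_rfl⟩

end Flow

section Step

variable {m n r : ℕ} {F : ℝ → Matrix (Fin m) (Fin n) ℝ → Matrix (Fin m) (Fin n) ℝ}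
  {A : ℝ → Matrix (Fin m) (Fin n) ℝ} {a b h : ℝ} {L B : ℝ≥0} {ε ρ e θ : ℝ}
  {U U₀ U₁ : Matrix (Fin m) (Fin r) ℝ} {V V₀ V₁ : Matrix (Fin n) (Fin r) ℝ}

theorem IsSolutionOn.hasDerivWithinAt_mul_transpose {K : ℝ → Matrix (Fin m) (Fin r) ℝ}
    (hK : IsSolutionOn (fun t X => F t (X * Vᵀ) * V) a b K) {t : ℝ} (ht : t ∈ Icc a b) :
    HasDerivWithinAt (fun t => K t * Vᵀ) (F t (K t * Vᵀ) * V * Vᵀ) (Icc a b) t := by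
  simpa only [Matrix.one_mul] using
    hasDerivWithinAt_mul_mul (hK t ht) (1 : Matrix (Fin m) (Fin m) ℝ) Vᵀ

theorem IsLipschitzBoundedFlow.norm_sub_kStep_le (hF : IsLipschitzBoundedFlow F A a (a + h) L B)
    (hV : HasOrthonormalCols V) {K : ℝ → Matrix (Fin m) (Fin r) ℝ}
    (hK : IsSolutionOn (fun t X => F t (X * Vᵀ) * V) a (a + h) K) {s t : ℝ}
    (hs : s ∈ Icc a (a + h)) (ht : t ∈ Icc a (a + h)) :
    ‖A s - K t * Vᵀ‖ ≤ ‖A a - K a * Vᵀ‖ + 2 * B * h :=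
  norm_sub_le_add_two_mul_of_norm_hasDerivWithinAt_le hF.isSolutionOn
    (fun _ => hK.hasDerivWithinAt_mul_transpose) (fun t ht => hF.norm_le t ht _)
    (fun t ht => (hV.norm_mul_transpose _).trans_le <|
      (hV.norm_mul_le _).trans (hF.norm_le t ht _)) hs ht

theorem norm_orthComplProj_mul_le_of_kStep
    (hF : IsNearlyTangentFlow F A r a (a + h) L B ε ρ) (hh : 0 ≤ h)
    (hV₀ : HasOrthonormalCols V₀) (hU₁ : HasOrthonormalCols U₁)
    {K : ℝ → Matrix (Fin m) (Fin r) ℝ} {R : Matrix (Fin r) (Fin r) ℝ}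
    (hK : IsSolutionOn (fun t X => F t (X * V₀ᵀ) * V₀) a (a + h) K) (hKR : K (a + h) = U₁ * R)
    (he : ‖K a * V₀ᵀ - A a‖ ≤ e) (hρ : e + 2 * B * h < ρ) :
    ‖orthComplProj U₁ * (K a * V₀ᵀ + (A (a + h) - A a))‖ ≤
      (2 * L * (e + 2 * B * h) + ε) * h := by
  have ha : a ∈ Icc a (a + h) := ⟨le_rfl, by linarith⟩
  have hb : a + h ∈ Icc a (a + h) := ⟨by linarith, le_rfl⟩
  have hdist {s t : ℝ} (hs : s ∈ Icc a (a + h)) (ht : t ∈ Icc a (a + h)) :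
      ‖A s - K t * V₀ᵀ‖ ≤ e + 2 * B * h :=
    (hF.norm_sub_kStep_le hV₀ hK hs ht).trans (by rw [norm_sub_rev]; gcongr)
  have hderiv (t : ℝ) (ht : t ∈ Icc a (a + h)) : HasDerivWithinAt
      (fun t => orthComplProj U₁ * (A t - K t * V₀ᵀ))
      (orthComplProj U₁ * (F t (A t) - F t (K t * V₀ᵀ) * V₀ * V₀ᵀ)) (Icc a (a + h)) t := by
    simpa only [Matrix.mul_one] using hasDerivWithinAt_mul_mul
      ((hF.isSolutionOn t ht).fun_sub (hK.hasDerivWithinAt_mul_transpose ht))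
      (orthComplProj U₁) (1 : Matrix (Fin n) (Fin n) ℝ)
  have hbound (t : ℝ) (ht : t ∈ Icc a (a + h)) :
      ‖orthComplProj U₁ * (F t (A t) - F t (K t * V₀ᵀ) * V₀ * V₀ᵀ)‖ ≤
        2 * L * (e + 2 * B * h) + ε := by
    -- Unlike `K(t) V₀ᵀ`, the endpoint `K(a + h) V₀ᵀ` has the column space of `U₁`, so that
    -- the normal component of `F` can be controlled there.
    have hnormal : ‖orthComplProj U₁ * F t (K (a + h) * V₀ᵀ) * orthComplProj V₀‖ ≤ ε := by
      have hnear : ‖K (a + h) * V₀ᵀ - A t‖ < ρ :=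
        (norm_sub_rev _ _).trans_lt ((hdist ht hb).trans_lt hρ)
      rw [hKR] at hnear ⊢
      exact hF.norm_normal_le t ht U₁ R V₀ hU₁ hV₀ hnear
    linarith [hU₁.norm_orthComplProj_mul_sub_le hV₀ (F t (A t)) (F t (K t * V₀ᵀ))
      (F t (K (a + h) * V₀ᵀ)), hF.norm_apply_sub_le ht (hdist ht ht),
      hF.norm_apply_sub_le ht (hdist ht hb)]
  have hend : orthComplProj U₁ * (K (a + h) * V₀ᵀ) = 0 := by
    rw [hKR, Matrix.mul_assoc, hU₁.orthComplProj_mul]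
  have hincrement : orthComplProj U₁ * (K a * V₀ᵀ + (A (a + h) - A a)) =
      orthComplProj U₁ * (A (a + h) - K (a + h) * V₀ᵀ) -
        orthComplProj U₁ * (A a - K a * V₀ᵀ) := by
    rw [Matrix.mul_sub _ (A (a + h)), hend, sub_zero, ← Matrix.mul_sub]
    congr 1
    abel
  rw [hincrement]
  exact norm_sub_le_of_norm_hasDerivWithinAt_le hderiv hbound ha hb

theorem norm_mul_orthComplProj_le_of_lStep
    (hF : IsNearlyTangentFlow F A r a (a + h) L B ε ρ) (hh : 0 ≤ h)
    (hU₀ : HasOrthonormalCols U₀) (hV₁ : HasOrthonormalCols V₁)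
    {K : ℝ → Matrix (Fin n) (Fin r) ℝ} {R : Matrix (Fin r) (Fin r) ℝ}
    (hK : IsSolutionOn (fun t X => (F t (U₀ * Xᵀ))ᵀ * U₀) a (a + h) K) (hKR : K (a + h) = V₁ * R)
    (he : ‖U₀ * (K a)ᵀ - A a‖ ≤ e) (hρ : e + 2 * B * h < ρ) :
    ‖(U₀ * (K a)ᵀ + (A (a + h) - A a)) * orthComplProj V₁‖ ≤
      (2 * L * (e + 2 * B * h) + ε) * h := by
  have htranspose : (U₀ * (K a)ᵀ)ᵀ = K a * U₀ᵀ := by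
    rw [Matrix.transpose_mul, Matrix.transpose_transpose]
  rw [← Matrix.frobenius_norm_transpose, Matrix.transpose_sub, htranspose] at he
  rw [← Matrix.frobenius_norm_transpose, Matrix.transpose_mul, transpose_orthComplProj,
    Matrix.transpose_add, Matrix.transpose_sub, htranspose]
  refine norm_orthComplProj_mul_le_of_kStep hF.transpose hh hU₀ hV₁ ?_ hKR he hρ
  simpa only [Matrix.transpose_mul, Matrix.transpose_transpose] using hK

/-- The Galerkin projection `X ↦ U Uᵀ X V Vᵀ` onto the matrices with column space in that of `U`
and row space in that of `Vᵀ`; the S-step solves the differential equation projected by it. -/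
noncomputable def galerkinProj (U : Matrix (Fin m) (Fin r) ℝ) (V : Matrix (Fin n) (Fin r) ℝ) :
    Matrix (Fin m) (Fin n) ℝ →ₗ[ℝ] Matrix (Fin m) (Fin n) ℝ :=
  mulRightLinearMap (Fin m) ℝ Vᵀ ∘ₗ mulLeftLinearMap (Fin r) ℝ U ∘ₗ
    mulRightLinearMap (Fin r) ℝ V ∘ₗ mulLeftLinearMap (Fin n) ℝ Uᵀ

theorem galerkinProj_apply (X : Matrix (Fin m) (Fin n) ℝ) :
    galerkinProj U V X = U * (Uᵀ * X * V) * Vᵀ :=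
  rfl

theorem norm_galerkinProj_le (hU : HasOrthonormalCols U) (hV : HasOrthonormalCols V)
    (X : Matrix (Fin m) (Fin n) ℝ) : ‖galerkinProj U V X‖ ≤ ‖X‖ := by
  rw [galerkinProj_apply, hV.norm_mul_transpose, hU.norm_mul]
  exact (hV.norm_mul_le _).trans (hU.norm_transpose_mul_le _)

theorem norm_sub_galerkinProj_le (hU : HasOrthonormalCols U) (X : Matrix (Fin m) (Fin n) ℝ) :
    ‖X - galerkinProj U V X‖ ≤ ‖orthComplProj U * X‖ + ‖X * orthComplProj V‖ := by
  have hsplit : X - galerkinProj U V X =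
      orthComplProj U * X + U * (Uᵀ * (X * orthComplProj V)) := by
    simp only [galerkinProj_apply, orthComplProj, Matrix.sub_mul, Matrix.mul_sub, Matrix.one_mul,
      Matrix.mul_one, Matrix.mul_assoc]
    abel
  calc ‖X - galerkinProj U V X‖
      ≤ ‖orthComplProj U * X‖ + ‖U * (Uᵀ * (X * orthComplProj V))‖ :=
        hsplit ▸ norm_add_le _ _
    _ ≤ ‖orthComplProj U * X‖ + ‖X * orthComplProj V‖ := by
        rw [hU.norm_mul]
        gcongr
        exact hU.norm_transpose_mul_le _

theorem norm_galerkinProj_sub_le (hU : HasOrthonormalCols U) (hV : HasOrthonormalCols V)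
    (X Y D : Matrix (Fin m) (Fin n) ℝ) :
    ‖galerkinProj U V Y - X‖ ≤ ‖Y - X‖ + ‖Y + D - galerkinProj U V (Y + D)‖ + 2 * ‖D‖ := by
  have hsplit : galerkinProj U V Y - X =
      (Y - X) - (Y + D - galerkinProj U V (Y + D)) + (D - galerkinProj U V D) := by
    rw [map_add]
    abel
  rw [hsplit]
  linarith [norm_add_le ((Y - X) - (Y + D - galerkinProj U V (Y + D))) (D - galerkinProj U V D),
    norm_sub_le (Y - X) (Y + D - galerkinProj U V (Y + D)),
    norm_sub_le D (galerkinProj U V D), norm_galerkinProj_le hU hV D]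

theorem norm_mul_mul_transpose_sub_le_of_sStep
    (hF : IsLipschitzBoundedFlow F A a (a + h) L B) (hh : 0 ≤ h)
    (hU : HasOrthonormalCols U) (hV : HasOrthonormalCols V) {S : ℝ → Matrix (Fin r) (Fin r) ℝ}
    (hS : IsSolutionOn (fun t X => Uᵀ * F t (U * X * Vᵀ) * V) a (a + h) S)
    {Y₀ : Matrix (Fin m) (Fin n) ℝ} (hS₀ : S a = Uᵀ * Y₀ * V) (he : ‖Y₀ - A a‖ ≤ e)
    (hθ : ‖Y₀ + (A (a + h) - A a) - galerkinProj U V (Y₀ + (A (a + h) - A a))‖ ≤ θ) :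
    ‖U * S (a + h) * Vᵀ - A (a + h)‖ ≤ e + θ + L * (e + θ + 4 * B * h) * h := by
  have ha : a ∈ Icc a (a + h) := ⟨le_rfl, by linarith⟩
  have hb : a + h ∈ Icc a (a + h) := ⟨by linarith, le_rfl⟩
  set W := Y₀ + (A (a + h) - A a) with hW
  have hZ (t : ℝ) (ht : t ∈ Icc a (a + h)) : HasDerivWithinAt (fun t => U * S t * Vᵀ)
      (galerkinProj U V (F t (U * S t * Vᵀ))) (Icc a (a + h)) t :=
    hasDerivWithinAt_mul_mul (hS t ht) U Vᵀ
  have hA (t : ℝ) (ht : t ∈ Icc a (a + h)) : HasDerivWithinAt (fun t => galerkinProj U V (A t))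
      (galerkinProj U V (F t (A t))) (Icc a (a + h)) t :=
    hasDerivWithinAt_mul_mul (hasDerivWithinAt_mul_mul (hF.isSolutionOn t ht) Uᵀ V) U Vᵀ
  have hstart : ‖U * S a * Vᵀ - A a‖ ≤ e + θ + 2 * B * h := by
    rw [hS₀, ← galerkinProj_apply]
    linarith [norm_galerkinProj_sub_le hU hV (A a) Y₀ (A (a + h) - A a), hF.norm_sub_le hh]
  have hdist (t : ℝ) (ht : t ∈ Icc a (a + h)) :
      ‖U * S t * Vᵀ - A t‖ ≤ e + θ + 4 * B * h := by
    linarith [norm_sub_le_add_two_mul_of_norm_hasDerivWithinAt_le hZ hF.isSolutionOn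
      (fun t ht => (norm_galerkinProj_le hU hV _).trans (hF.norm_le t ht _))
      (fun t ht => hF.norm_le t ht _) ht ht]
  have hincrement := norm_sub_le_of_norm_hasDerivWithinAt_le
    (fun t ht => (hZ t ht).fun_sub (hA t ht)) (fun t ht => by
      rw [← map_sub]
      exact (norm_galerkinProj_le hU hV _).trans (hF.norm_apply_sub_le ht (hdist t ht))) ha hb
  have hsplit : U * S (a + h) * Vᵀ - A (a + h) =
      ((U * S (a + h) * Vᵀ - galerkinProj U V (A (a + h))) -
        (U * S a * Vᵀ - galerkinProj U V (A a))) - (W - galerkinProj U V W) + (Y₀ - A a) := by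
    rw [hS₀, ← galerkinProj_apply, hW, map_add, map_sub]
    abel
  rw [hsplit]
  refine (norm_add_le _ _).trans ?_
  linarith [norm_sub_le ((U * S (a + h) * Vᵀ - galerkinProj U V (A (a + h))) -
    (U * S a * Vᵀ - galerkinProj U V (A a))) (W - galerkinProj U V W)]

end Step

section ErrorRecursion

theorem le_exp_mul_of_conditional_recursion {u : ℕ → ℝ} {α δ g h T : ℝ} (hα : 0 ≤ α) (hg : 0 ≤ g)
    (hh : 0 ≤ h) (hu : ∀ k, 0 ≤ u k) (hδ : u 0 ≤ δ)
    (hrec : ∀ k : ℕ, ((k + 1 : ℕ) : ℝ) * h ≤ T → u k ≤ Real.exp (α * T) * (δ + T * g) →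
      u (k + 1) ≤ (1 + h * α) * u k + h * g) (N : ℕ) (hN : N * h ≤ T) :
    u N ≤ Real.exp (α * T) * (δ + T * g) := by
  induction N using Nat.strong_induction_on with | _ N ih
  have hstopped (k : ℕ) : u (min (k + 1) N) ≤ (1 + h * α) * u (min k N) + h * g := by
    rcases lt_or_ge k N with hk | hk
    · have hkN : ((k + 1 : ℕ) : ℝ) * h ≤ T := le_trans (by gcongr; exact hk) hN
      rw [min_eq_left (Nat.succ_le_of_lt hk), min_eq_left hk.le]
      exact hrec k hkN (ih k hk (le_trans (by gcongr) hN))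
    · rw [min_eq_right hk, min_eq_right (hk.trans k.le_succ)]
      nlinarith [mul_nonneg (mul_nonneg hh hα) (hu N), mul_nonneg hh hg]
  have hgronwall := discrete_gronwall (u := fun k => u (min k N)) (b := fun _ => h * g)
    (c := fun _ => h * α) (hu _) (fun k _ => hstopped k) (fun _ _ => mul_nonneg hh hα)
    (fun _ _ => mul_nonneg hh hg) N.zero_le
  simp only [min_self, Nat.zero_min, Finset.sum_const, Nat.card_Ico, tsub_zero,
    nsmul_eq_mul] at hgronwall
  calc u N ≤ (u 0 + N * h * g) * Real.exp (α * (N * h)) := by convert hgronwall using 3 <;> ring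
    _ ≤ (δ + T * g) * Real.exp (α * T) := by
      have hδg : 0 ≤ δ + T * g := by
        have := (mul_nonneg N.cast_nonneg hh).trans hN
        nlinarith [hu 0, mul_nonneg this hg]
      gcongr
    _ = Real.exp (α * T) * (δ + T * g) := mul_comm _ _

variable {m n r : ℕ} {F : ℝ → Matrix (Fin m) (Fin n) ℝ → Matrix (Fin m) (Fin n) ℝ}

theorem norm_integratorStep_sub_le {A : ℝ → Matrix (Fin m) (Fin n) ℝ} {a h ε ρ e : ℝ} {L B : ℝ≥0}
    {U₀ U₁ : Matrix (Fin m) (Fin r) ℝ} {S₀ S₁ : Matrix (Fin r) (Fin r) ℝ}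
    {V₀ V₁ : Matrix (Fin n) (Fin r) ℝ} (hF : IsNearlyTangentFlow F A r a (a + h) L B ε ρ)
    (hh : 0 ≤ h) (hU₀ : HasOrthonormalCols U₀) (hV₀ : HasOrthonormalCols V₀)
    (hstep : IsIntegratorStep F a h U₀ S₀ V₀ U₁ S₁ V₁) (he : ‖U₀ * S₀ * V₀ᵀ - A a‖ ≤ e)
    (hρ : e + 2 * B * h < ρ) :
    ‖U₁ * S₁ * V₁ᵀ - A (a + h)‖ ≤ e + 2 * ((2 * L * (e + 2 * B * h) + ε) * h) +
      L * (e + 2 * ((2 * L * (e + 2 * B * h) + ε) * h) + 4 * B * h) * h := by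
  obtain ⟨⟨K, R, hK, hK₀, hKR, hU₁, -⟩, ⟨K', R', hK', hK₀', hKR', hV₁, -⟩, S, hS, hS₀, rfl⟩ := hstep
  have hKstart : K a * V₀ᵀ = U₀ * S₀ * V₀ᵀ := by rw [hK₀]
  have hLstart : U₀ * (K' a)ᵀ = U₀ * S₀ * V₀ᵀ := by
    rw [hK₀', Matrix.transpose_mul, Matrix.transpose_transpose, Matrix.mul_assoc]
  have hSstart : S a = U₁ᵀ * (U₀ * S₀ * V₀ᵀ) * V₁ := by
    rw [hS₀, Matrix.transpose_mul, Matrix.transpose_transpose]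
    simp only [Matrix.mul_assoc]
  have hrange := norm_orthComplProj_mul_le_of_kStep hF hh hV₀ hU₁ hK hKR (hKstart ▸ he) hρ
  have hcorange := norm_mul_orthComplProj_le_of_lStep hF hh hU₀ hV₁ hK' hKR' (hLstart ▸ he) hρ
  rw [hKstart] at hrange
  rw [hLstart] at hcorange
  refine norm_mul_mul_transpose_sub_le_of_sStep hF.toIsLipschitzBoundedFlow hh hU₁ hV₁ hS hSstart he
    ((norm_sub_galerkinProj_le hU₁ _).trans ?_)
  linarith

theorem exists_stepBound_le (L B T : ℝ≥0) :
    ∃ α β κ : ℝ≥0, ∀ e ε h : ℝ, 0 ≤ e → 0 ≤ ε → 0 ≤ h → h ≤ T →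
      e + 2 * ((2 * L * (e + 2 * B * h) + ε) * h) +
        L * (e + 2 * ((2 * L * (e + 2 * B * h) + ε) * h) + 4 * B * h) * h ≤
      (1 + h * α) * e + h * (β * h + κ * ε) := by
  refine ⟨4 * L * (1 + L * T) + L, 8 * L * B * (1 + L * T) + 4 * L * B, 2 * (1 + L * T),
    fun e ε h he hε hh hhT => ?_⟩
  have hnonneg : 0 ≤ 2 * ((2 * L * (e + 2 * B * h) + ε) * h) := by positivity
  have hLh : (L : ℝ) * h ≤ L * T := by gcongr
  push_cast
  linarith [mul_le_mul_of_nonneg_right hLh hnonneg]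

variable {h T : ℝ} {U : ℕ → Matrix (Fin m) (Fin r) ℝ}
  {S : ℕ → Matrix (Fin r) (Fin r) ℝ} {V : ℕ → Matrix (Fin n) (Fin r) ℝ}

theorem hasOrthonormalCols_of_isIntegratorStep (hU₀ : HasOrthonormalCols (U 0))
    (hV₀ : HasOrthonormalCols (V 0))
    (hstep : ∀ k : ℕ, ((k + 1 : ℕ) : ℝ) * h ≤ T →
      IsIntegratorStep F (k * h) h (U k) (S k) (V k) (U (k + 1)) (S (k + 1)) (V (k + 1)))
    (k : ℕ) (hk : k * h ≤ T) : HasOrthonormalCols (U k) ∧ HasOrthonormalCols (V k) := by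
  cases k with
  | zero => exact ⟨hU₀, hV₀⟩
  | succ k =>
    obtain ⟨⟨_, _, _, _, _, hU, _⟩, ⟨_, _, _, _, _, hV, _⟩, _⟩ := hstep k hk
    exact ⟨hU, hV⟩

theorem exists_norm_integrator_succ_sub_le (L B T : ℝ≥0) :
    ∃ α β κ : ℝ≥0, ∀ {m n r : ℕ} {F : ℝ → Matrix (Fin m) (Fin n) ℝ → Matrix (Fin m) (Fin n) ℝ}
      {A : ℝ → Matrix (Fin m) (Fin n) ℝ} {ε ρ h : ℝ} {U : ℕ → Matrix (Fin m) (Fin r) ℝ}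
      {S : ℕ → Matrix (Fin r) (Fin r) ℝ} {V : ℕ → Matrix (Fin n) (Fin r) ℝ},
      IsNearlyTangentFlow F A r 0 T L B ε ρ → 0 ≤ ε → 0 ≤ h →
      HasOrthonormalCols (U 0) → HasOrthonormalCols (V 0) →
      (∀ k : ℕ, ((k + 1 : ℕ) : ℝ) * h ≤ T →
        IsIntegratorStep F (k * h) h (U k) (S k) (V k) (U (k + 1)) (S (k + 1)) (V (k + 1))) →
      ∀ k : ℕ, ((k + 1 : ℕ) : ℝ) * h ≤ T →
        ‖U k * S k * (V k)ᵀ - A (k * h)‖ + 2 * B * h < ρ →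
        ‖U (k + 1) * S (k + 1) * (V (k + 1))ᵀ - A ((k + 1 : ℕ) * h)‖ ≤
          (1 + h * α) * ‖U k * S k * (V k)ᵀ - A (k * h)‖ + h * (β * h + κ * ε) := by
  obtain ⟨α, β, κ, hbound⟩ := exists_stepBound_le L B T
  refine ⟨α, β, κ, fun {m n r F A ε ρ h U S V} hF hε hh hU₀ hV₀ hstep k hk hρ => ?_⟩
  have hkh : 0 ≤ k * h := by positivity
  have hsucc : ((k + 1 : ℕ) : ℝ) * h = k * h + h := by push_cast; ring
  have hcurrent := hstep k hk
  rw [hsucc] at hk ⊢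
  obtain ⟨hU, hV⟩ := hasOrthonormalCols_of_isIntegratorStep hU₀ hV₀ hstep k (by linarith)
  exact (norm_integratorStep_sub_le (hF.mono (Icc_subset_Icc hkh hk)) hh hU hV hcurrent le_rfl
    hρ).trans (hbound _ _ _ (norm_nonneg _) hε hh (by linarith))

end ErrorRecursion

theorem theorem4 (L B T : ℝ) :
    ∃ c₀ c₁ c₂ : ℝ, 0 ≤ c₀ ∧ 0 ≤ c₁ ∧ 0 ≤ c₂ ∧
      ∀ (m n r : ℕ) (F : ℝ → Matrix (Fin m) (Fin n) ℝ → Matrix (Fin m) (Fin n) ℝ)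
        (A : ℝ → Matrix (Fin m) (Fin n) ℝ) (ε δ ρ h : ℝ)
        (U : ℕ → Matrix (Fin m) (Fin r) ℝ) (S : ℕ → Matrix (Fin r) (Fin r) ℝ)
        (V : ℕ → Matrix (Fin n) (Fin r) ℝ),
        -- the exact solution
        IsSolutionOn F 0 T A →
        -- `F` is Lipschitz continuous and bounded
        (∀ t ∈ Icc 0 T, ∀ Y Y' : Matrix (Fin m) (Fin n) ℝ, ‖F t Y - F t Y'‖ ≤ L * ‖Y - Y'‖) →
        (∀ t ∈ Icc 0 T, ∀ Y : Matrix (Fin m) (Fin n) ℝ, ‖F t Y‖ ≤ B) →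
        -- the non-tangential part of `F` is `ε`-small on the rank-`r` matrices in the
        -- `ρ`-neighbourhood of the exact solution
        0 ≤ ε →
        (∀ t ∈ Icc 0 T, ∀ Y ∈ rankManifold m n r, ‖Y - A t‖ < ρ →
          ‖F t Y - tangentProj r Y (F t Y)‖ ≤ ε) →
        -- the starting value, in factored form, and its error
        HasOrthonormalCols (U 0) → HasOrthonormalCols (V 0) →
        ‖U 0 * S 0 * (V 0)ᵀ - A 0‖ ≤ δ →
        -- the steps of the integrator with step size `h`
        0 < h →
        (∀ k : ℕ, ((k + 1 : ℕ) : ℝ) * h ≤ T →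
          IsIntegratorStep F (k * h) h (U k) (S k) (V k) (U (k + 1)) (S (k + 1)) (V (k + 1))) →
        -- the neighbourhood is large enough to contain the approximations
        c₀ * δ + c₁ * ε + c₂ * h ≤ ρ →
        ∀ N : ℕ, (N : ℝ) * h ≤ T →
          ‖U N * S N * (V N)ᵀ - A (N * h)‖ ≤ c₀ * δ + c₁ * ε + c₂ * h := by
  obtain ⟨α, β, κ, hsucc⟩ := exists_norm_integrator_succ_sub_le L.toNNReal B.toNNReal T.toNNReal
  refine ⟨Real.exp (α * T.toNNReal), Real.exp (α * T.toNNReal) * T.toNNReal * κ,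
    Real.exp (α * T.toNNReal) * T.toNNReal * β + (2 * B.toNNReal + 1), by positivity, by positivity,
    by positivity, ?_⟩
  intro m n r F A ε δ ρ h U S V hA hLip hB hε hnormal hU₀ hV₀ hδ hh hstep hρ N hN
  have hT : (T.toNNReal : ℝ) = T := Real.coe_toNNReal T (le_trans (by positivity) hN)
  rw [hT] at hsucc hρ ⊢
  have hF := isNearlyTangentFlow_of_tangentProj hA hLip hB hnormal
  have hmargin : 0 ≤ (2 * B.toNNReal + 1) * h := by positivity
  have herror := le_exp_mul_of_conditional_recursion
    (u := fun k => ‖U k * S k * (V k)ᵀ - A (k * h)‖) (g := β * h + κ * ε) α.coe_nonneg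
    (by positivity) hh.le (fun _ => norm_nonneg _) (by simpa using hδ)
    (fun k hk hsmall => hsucc hF hε hh.le hU₀ hV₀ hstep k hk (by linarith)) N hN
  linarith
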